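/- Let $\mathcal S$ (states) and $\Theta$ (intent parameters) be finite sets, $\Theta\neq\emptyset$; for each $s\in\mathcal S$ let $\mathcal A(s)$ and $\mathcal D(s)$ be the nonempty finite sets of actions of the attacker and of the defender in state $s$ (they may be the same for all $s$); let $\mathcal T(\cdot\mid s,a,d)$ be a probability distribution on $\mathcal S$, $R(s,a,d,s';\theta)\in\mathbb R$ a reward function, and $\gamma\in[0,1)$. $\Delta(X)$ denotes the set of probability distributions on a finite set $X$. For $s\in\mathcal S$ and $\zeta\in\mathbb R^{\Theta}$ the dual game is the following zero-sum game. The initial state $s_0=s$ is revealed to both players. The attacker chooses $\theta\in\Theta$, possibly at random, and $\theta$ is not revealed to the defender. At each stage $t=0,1,2,\dots$ the attacker and the defender simultaneously choose actions $a_t\in\mathcal A(s_t)$ and $d_t\in\mathcal D(s_t)$ by behavioral strategies, i.e. at random with laws that depend on $(s_0,\theta,a_0,d_0,\dots,a_{t-1},d_{t-1},s_t)$ for the attacker and on $(s_0,a_0,d_0,\dots,a_{t-1},d_{t-1},s_t)$ for the defender; then $s_{t+1}$ is drawn from $\mathcal T(\cdot\mid s_t,a_t,d_t)$, and $a_t,d_t,s_{t+1}$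 are revealed to both players. The attacker maximizes, and the defender minimizes, $$\mathbb E\Big[\zeta(\theta)+\sum_{t\ge 0}\gamma^t R(s_t,a_t,d_t,s_{t+1};\theta)\Big].$$ Let $w(s,\zeta)$ be the maximin of this payoff over the strategies of the attacker (the choice of $\theta$ included) and of the defender. Then $w(s,\zeta)$ is the value of the dual game and both players have optimal strategies: the attacker has a strategy that guarantees at least $w(s,\zeta)$ against every strategy of the defender, and the defender has a strategy that concedes at most $w(s,\zeta)$ against every strategy of the attacker. Moreover, for all $s\in\mathcal S$ and $\zeta\in\mathbb R^\Theta$, $$w(s,\zeta)=[Hw](s,\zeta):=\min_{\pi,\,\xi}\ \max_{\mu}\ \big\{h_{\pi,\mu}(s,\zeta)+\gamma\,W_{\pi,\mu}(w,\xi;s)\big\},$$ where the minimum is over all $\pi\in\Delta(\mathcal D(s))$ and all families $\xi=(\xi_{a,s'})_{a\in\mathcal A(s),\,s'\in\mathcal S}$ of vectors $\xi_{a,s'}\in\mathbb R^\Theta$, the maximum is over all $\mu\in\Delta(\mathcal A(s)\times\Theta)$, both are attained, and $$h_{\pi,\mu}(s,\zeta)=\sum_{a,\vartheta}\mu(a,\vartheta)\Big(\zeta(\vartheta)+\sum_{d,s'}\pi(d)\,\mathcal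 T(s'\mid s,a,d)\,R(s,a,d,s';\vartheta)\Big),$$ $$W_{\pi,\mu}(w,\xi;s)=\sum_{a,d,s',\vartheta}\mu(a,\vartheta)\,\pi(d)\,\mathcal T(s'\mid s,a,d)\,\big(w(s',\xi_{a,s'})-\xi_{a,s'}(\vartheta)\big).$$ -/

import Mathlib

/-- The data shared by the primal game and its dual game: a finite set `S` of states, the finite sets
`A s` and `D s` of actions that the attacker and the defender may use in state `s`, a finite set `Θ`
of intent parameters, the transition law `T`, the reward `R` of the attacker and the discount factor.
Action sets that do not depend on the state are the case of constant families `A` and `D`. -/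
structure DualGame (S Θ : Type*) (A D : S → Type*) [Fintype S] where
  /-- `T s a d` is the conditional law of the next state. -/
  T : (s : S) → A s → D s → stdSimplex ℝ S
  /-- `R s a d s' θ` is the reward of the attacker, which is the cost of the defender. -/
  R : (s : S) → A s → D s → S → Θ → ℝ
  /-- The discount factor. -/
  γ : ℝ
  γ_nonneg : 0 ≤ γ
  γ_lt_one : γ < 1

namespace DualGame

/-- The public past before stage `t`: the list of the triples `(s₀, a₀, d₀), …,
`(sₜ₋₁, aₜ₋₁, dₜ₋₁)` in chronological order. Together with the current state `sₜ` it is the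
information of the defender at stage `t`. -/
abbrev Past {S : Type*} (A D : S → Type*) : Type _ := List (Σ s : S, A s × D s)

/-- A strategy of the defender: at every stage, a mixed action that depends on the past and on the
current state. -/
abbrev DefenderStrategy {S : Type*} (A D : S → Type*) [∀ s, Fintype (D s)] : Type _ :=
  Past A D → (s : S) → stdSimplex ℝ (D s)

/-- A strategy of the attacker in the dual game: after the initial state has been revealed it chooses
the intent parameter (possibly at random); then, at every stage, it uses a mixed action that depends
on the chosen parameter, on the past and on the current state. -/
structure AttackerStrategy {S : Type*} (Θ : Type*) (A D : S → Type*) [Fintype Θ]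
    [∀ s, Fintype (A s)] where
  /-- The law of the intent parameter, given the initial state. -/
  intent : S → stdSimplex ℝ Θ
  /-- The mixed action. -/
  act : Θ → Past A D → (s : S) → stdSimplex ℝ (A s)

section

variable {S Θ : Type*} {A D : S → Type*} [Fintype S] [Fintype Θ] [∀ s, Fintype (A s)]
  [∀ s, Fintype (D s)]

/-- `G.stageReward θ α β t h s` is the conditional expectation, given that the past is `h`, that the
current state is `s` and that the attacker has chosen `θ`, of the reward `R` that is received `t`
stages later, when the players act according to `α` and `β`. -/
def stageReward (G : DualGame S Θ A D) (θ : Θ) (α : Past A D → (s : S) → stdSimplex ℝ (A s))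
    (β : DefenderStrategy A D) : ℕ → Past A D → S → ℝ
  | 0, h, s => ∑ a : A s, ∑ d : D s, ∑ s' : S,
      (α h s).1 a * (β h s).1 d * (G.T s a d).1 s' * G.R s a d s' θ
  | t + 1, h, s => ∑ a : A s, ∑ d : D s, ∑ s' : S,
      (α h s).1 a * (β h s).1 d * (G.T s a d).1 s' *
        G.stageReward θ α β t (h ++ [⟨s, (a, d)⟩]) s'

/-- The expected payoff of the attacker in the dual game with initial state `s` and parameter `ζ`:
the expectation of `ζ(θ) + ∑ₜ γᵗ R(sₜ, aₜ, dₜ, sₜ₊₁; θ)`, where `θ` is chosen by the attacker. -/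
noncomputable def dualPayoff (G : DualGame S Θ A D) (s : S) (ζ : Θ → ℝ)
    (σ : AttackerStrategy Θ A D) (β : DefenderStrategy A D) : ℝ :=
  ∑ θ, (σ.intent s).1 θ * (ζ θ + ∑' t : ℕ, G.γ ^ t * G.stageReward θ (σ.act θ) β t [] s)

/-- The value function of the dual game: the maximin payoff of the attacker. -/
noncomputable def dualValue (G : DualGame S Θ A D) (s : S) (ζ : Θ → ℝ) : ℝ :=
  ⨆ σ : AttackerStrategy Θ A D, ⨅ β : DefenderStrategy A D, G.dualPayoff s ζ σ β

/-- The instantaneous reward of the one-stage dual game. -/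
def instReward (G : DualGame S Θ A D) (s : S) (ζ : Θ → ℝ) (π : stdSimplex ℝ (D s))
    (μ : stdSimplex ℝ (A s × Θ)) : ℝ :=
  ∑ a : A s, ∑ θ : Θ, μ.1 (a, θ) *
    (ζ θ + ∑ d : D s, ∑ s' : S, π.1 d * (G.T s a d).1 s' * G.R s a d s' θ)

/-- The expected value of the continuation game, where `w` is used as the value function and
`ξ a s'` as the parameter after the action `a` of the attacker and the successor state `s'`. -/
def contReward (G : DualGame S Θ A D) (w : S → (Θ → ℝ) → ℝ) (s : S) (π : stdSimplex ℝ (D s))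
    (ξ : A s → S → Θ → ℝ) (μ : stdSimplex ℝ (A s × Θ)) : ℝ :=
  ∑ a : A s, ∑ d : D s, ∑ s' : S, ∑ θ : Θ,
    μ.1 (a, θ) * π.1 d * (G.T s a d).1 s' * (w s' (ξ a s') - ξ a s' θ)

/-- `G.IsDualBackup w s ζ x` says that `x` is the minimum over the pairs `(π, ξ)` of the maximum over
`μ` of `instReward + γ * contReward`, the minimum and the maximum being attained. (For every `(π, ξ)`
the maximum exists when `A s` and `Θ` are nonempty.) -/
def IsDualBackup (G : DualGame S Θ A D) (w : S → (Θ → ℝ) → ℝ) (s : S) (ζ : Θ → ℝ) (x : ℝ) : Prop :=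
  IsLeast {m : ℝ | ∃ (π : stdSimplex ℝ (D s)) (ξ : A s → S → Θ → ℝ),
    IsGreatest (Set.range fun μ : stdSimplex ℝ (A s × Θ) =>
      G.instReward s ζ π μ + G.γ * G.contReward w s π ξ μ) m} x

end

end DualGame

/-! Only the vectors in `ℝ^Θ` that the defender can concede, one entry per intent, matter. They form
the sets `concessions s`, the greatest fixed point of a one-stage operator that mixes the defender's
action and assigns a concedable vector to each pair (attacker action, next state). Every vector is
kept within `payoffBound`, so a cost cannot be deferred forever: after `n` stages the error is at
most of order `γ ^ n`. Coinduction transfers convexity, compactness and nonemptiness to the greatest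
fixed point.

The value is `min_v max_θ (ζ θ + v θ)` over `v ∈ concessions s`. The defender attains it by keeping
track of the vector still promised (`exists_defenderStrategy`). For the attacker, a minimax argument
turns the minimum into a prior `p` with `∑ p θ * (ζ θ + v θ)` at least the value for all concedable
`v` (`IsConcessionValue.exists_prior`); a minimax argument at each stage then preserves such a
linear guarantee for the updated weights of the intents (`exists_attacker_action`,
`exists_attackerStrategy`).

The Bellman equation comes from the same formula: `w s' ξ - ξ` always dominates a concedable vector,
and for `ξ = -x` with `x` concedable it is itself dominated by `x`, since then `w s' ξ ≤ 0`. -/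

/-- A minimax theorem for functions that are affine in both variables, in the form of a single
choice of `y` against all `x`. -/
theorem exists_forall_le_of_forall_exists_le {E F : Type*}
    [TopologicalSpace E] [AddCommGroup E] [Module ℝ E] [IsTopologicalAddGroup E]
    [ContinuousSMul ℝ E] [TopologicalSpace F] [AddCommGroup F] [Module ℝ F]
    [IsTopologicalAddGroup F] [ContinuousSMul ℝ F] {X : Set E} {Y : Set F} (f : E → F → ℝ)
    (hX : IsCompact X) (cX : Convex ℝ X) (nX : X.Nonempty)
    (hY : IsCompact Y) (cY : Convex ℝ Y) (nY : Y.Nonempty)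
    (hfx : ∀ x, Continuous (f x)) (hfy : ∀ y, Continuous fun x => f x y)
    (afx : ∀ x y y' (a b : ℝ), a + b = 1 → f x (a • y + b • y') = a * f x y + b * f x y')
    (afy : ∀ y x x' (a b : ℝ), a + b = 1 → f (a • x + b • x') y = a * f x y + b * f x' y)
    {c : ℝ} (h : ∀ x ∈ X, ∃ y ∈ Y, c ≤ f x y) : ∃ y ∈ Y, ∀ x ∈ X, c ≤ f x y := by
  obtain ⟨a, ha, b, hb, hab⟩ := Sion.exists_isSaddlePointOn (f := f) nX cX hX
    (fun y _ => (hfy y).continuousOn.lowerSemicontinuousOn)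
    (fun y _ => ConvexOn.quasiconvexOn ⟨cX, fun x _ x' _ a b _ _ hab => (afy y x x' a b hab).le⟩)
    cY nY hY
    (fun x _ => (hfx x).continuousOn.upperSemicontinuousOn)
    (fun x _ => ConcaveOn.quasiconcaveOn ⟨cY, fun y _ y' _ a b _ _ hab => (afx x y y' a b hab).ge⟩)
  obtain ⟨y, hy, hc⟩ := h a ha
  exact ⟨b, hb, fun x hx => hc.trans (hab x hx y hy)⟩

/-! ### One-stage averages and costs of the defender. -/

namespace DualGame

section

variable {S Θ : Type*} {A D : S → Type*} [Fintype S] [∀ s, Fintype (D s)]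

/-- The expectation, given the action `a` of the attacker and the law `π` of the action of the
defender, of a function of the action of the defender and of the next state. -/
def defAvg (G : DualGame S Θ A D) (s : S) (π : D s → ℝ) (a : A s) (f : D s → S → ℝ) : ℝ :=
  ∑ d : D s, ∑ s' : S, π d * (G.T s a d).1 s' * f d s'

theorem defAvg_mono (G : DualGame S Θ A D) {s : S} {π : D s → ℝ} (hπ : ∀ d, 0 ≤ π d) (a : A s)
    {f g : D s → S → ℝ} (h : ∀ d s', f d s' ≤ g d s') : G.defAvg s π a f ≤ G.defAvg s π a g :=
  Finset.sum_le_sum fun d _ => Finset.sum_le_sum fun s' _ =>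
    mul_le_mul_of_nonneg_left (h d s') (mul_nonneg (hπ d) ((G.T s a d).2.1 s'))

theorem defAvg_const (G : DualGame S Θ A D) {s : S} {π : D s → ℝ} (hπ : ∑ d, π d = 1) (a : A s)
    (c : ℝ) : G.defAvg s π a (fun _ _ => c) = c := by
  have h (d : D s) : ∑ s', (G.T s a d).1 s' = 1 := (G.T s a d).2.2
  simp [defAvg, ← Finset.sum_mul, ← Finset.mul_sum, h, hπ]

theorem defAvg_add (G : DualGame S Θ A D) (s : S) (π : D s → ℝ) (a : A s) (f g : D s → S → ℝ) :
    G.defAvg s π a (fun d s' => f d s' + g d s') = G.defAvg s π a f + G.defAvg s π a g := by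
  simp [defAvg, mul_add, Finset.sum_add_distrib]

theorem defAvg_mul (G : DualGame S Θ A D) (s : S) (π : D s → ℝ) (a : A s) (c : ℝ)
    (f : D s → S → ℝ) : G.defAvg s π a (fun d s' => c * f d s') = c * G.defAvg s π a f := by
  simp only [defAvg, Finset.mul_sum]
  exact Finset.sum_congr rfl fun d _ => Finset.sum_congr rfl fun s' _ => by ring

theorem defAvg_sum (G : DualGame S Θ A D) {ι : Type*} (I : Finset ι) (s : S) (π : D s → ℝ)
    (a : A s) (f : ι → D s → S → ℝ) :
    G.defAvg s π a (fun d s' => ∑ i ∈ I, f i d s') = ∑ i ∈ I, G.defAvg s π a (f i) := by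
  simp only [defAvg, Finset.mul_sum]
  exact (Finset.sum_congr rfl fun d _ => Finset.sum_comm).trans Finset.sum_comm

theorem abs_defAvg_le (G : DualGame S Θ A D) {s : S} {π : D s → ℝ} (hπ : π ∈ stdSimplex ℝ (D s))
    (a : A s) {f : D s → S → ℝ} {c : ℝ} (h : ∀ d s', |f d s'| ≤ c) : |G.defAvg s π a f| ≤ c := by
  rw [abs_le]
  constructor
  · rw [← G.defAvg_const hπ.2 a (-c)]
    exact G.defAvg_mono hπ.1 a fun d s' => (abs_le.1 (h d s')).1
  · rw [← G.defAvg_const hπ.2 a c]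
    exact G.defAvg_mono hπ.1 a fun d s' => (abs_le.1 (h d s')).2

/-- The cost of the defender, as a function of the action `a` of the attacker and of the intent
parameter, when it uses `π` and concedes `x a s'` after the action `a` and the new state `s'`. -/
def stageCost (G : DualGame S Θ A D) (s : S) (π : D s → ℝ) (x : A s → S → Θ → ℝ) (a : A s)
    (θ : Θ) : ℝ :=
  G.defAvg s π a fun d s' => G.R s a d s' θ + G.γ * x a s' θ

theorem stageCost_mono (G : DualGame S Θ A D) {s : S} {π : D s → ℝ} (hπ : ∀ d, 0 ≤ π d)
    {x y : A s → S → Θ → ℝ} (a : A s) (θ : Θ) (h : ∀ s', x a s' θ ≤ y a s' θ) :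
    G.stageCost s π x a θ ≤ G.stageCost s π y a θ :=
  G.defAvg_mono hπ a fun d s' => by
    have := mul_le_mul_of_nonneg_left (h s') G.γ_nonneg
    linarith

theorem continuous_stageCost (G : DualGame S Θ A D) (s : S) :
    Continuous fun p : (D s → ℝ) × (A s → S → Θ → ℝ) => G.stageCost s p.1 p.2 := by
  unfold stageCost defAvg
  fun_prop

/-- Stage costs can be mixed, with continuations that are mixed accordingly. -/
theorem exists_stageCost_eq (G : DualGame S Θ A D) {K : S → Set (Θ → ℝ)}
    (hK : ∀ s, Convex ℝ (K s)) {s : S} {π₁ π₂ : D s → ℝ} (h₁ : π₁ ∈ stdSimplex ℝ (D s))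
    (h₂ : π₂ ∈ stdSimplex ℝ (D s)) {x₁ x₂ : A s → S → Θ → ℝ} (k₁ : ∀ a s', x₁ a s' ∈ K s')
    (k₂ : ∀ a s', x₂ a s' ∈ K s') {u v : ℝ} (hu : 0 ≤ u) (hv : 0 ≤ v) (huv : u + v = 1) :
    ∃ π ∈ stdSimplex ℝ (D s), ∃ x : A s → S → Θ → ℝ, (∀ a s', x a s' ∈ K s') ∧
      ∀ a θ, G.stageCost s π x a θ = u * G.stageCost s π₁ x₁ a θ + v * G.stageCost s π₂ x₂ a θ := by
  -- The cost is not affine in `(π, x)` jointly, but it sees `x a s'` only through its product with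
  -- the probability `P π a s'` of reaching `s'`. So the continuations are mixed with weights
  -- proportional to `u * P π₁ a s'` and `v * P π₂ a s'`.
  let P (π : D s → ℝ) (a : A s) (s' : S) : ℝ := ∑ d, π d * (G.T s a d).1 s'
  have hP (π : D s → ℝ) (hπ : π ∈ stdSimplex ℝ (D s)) (a : A s) (s' : S) : 0 ≤ P π a s' :=
    Finset.sum_nonneg fun d _ => mul_nonneg (hπ.1 d) ((G.T s a d).2.1 s')
  have key (π : D s → ℝ) (x : A s → S → Θ → ℝ) (a : A s) (θ : Θ) : G.stageCost s π x a θ =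
      (∑ d, ∑ s', π d * (G.T s a d).1 s' * G.R s a d s' θ) +
        G.γ * ∑ s', P π a s' * x a s' θ := by
    rw [stageCost, defAvg_add, defAvg_mul]
    simp only [P, defAvg, Finset.sum_mul]
    rw [Finset.sum_comm (s := (Finset.univ : Finset S))]
  have hx (a : A s) (s' : S) : ∃ y ∈ K s', ∀ θ,
      (u * P π₁ a s' + v * P π₂ a s') * y θ =
        u * P π₁ a s' * x₁ a s' θ + v * P π₂ a s' * x₂ a s' θ := by
    have n₁ := mul_nonneg hu (hP π₁ h₁ a s')
    have n₂ := mul_nonneg hv (hP π₂ h₂ a s')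
    -- If both weights vanish, `s'` does not contribute and any point of `K s'` will do.
    rcases (add_nonneg n₁ n₂).eq_or_lt with h0 | h0
    · have e₁ : u * P π₁ a s' = 0 := by linarith
      have e₂ : v * P π₂ a s' = 0 := by linarith
      exact ⟨x₁ a s', k₁ a s', fun θ => by rw [e₁, e₂]; ring⟩
    · refine ⟨_, hK s' (k₁ a s') (k₂ a s') (div_nonneg n₁ h0.le) (div_nonneg n₂ h0.le)
        (by rw [← add_div, div_self h0.ne']), fun θ => ?_⟩
      simp only [Pi.add_apply, Pi.smul_apply, smul_eq_mul]
      field_simp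
  choose x hxK hx using hx
  refine ⟨u • π₁ + v • π₂, convex_stdSimplex ℝ (D s) h₁ h₂ hu hv huv, x, hxK, fun a θ => ?_⟩
  have hPadd (s' : S) : P (u • π₁ + v • π₂) a s' = u * P π₁ a s' + v * P π₂ a s' := by
    simp only [P, Finset.mul_sum, ← Finset.sum_add_distrib, Pi.add_apply, Pi.smul_apply,
      smul_eq_mul]
    exact Finset.sum_congr rfl fun d _ => by ring
  have h3 : ∑ s', P (u • π₁ + v • π₂) a s' * x a s' θ =
      u * ∑ s', P π₁ a s' * x₁ a s' θ + v * ∑ s', P π₂ a s' * x₂ a s' θ := by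
    simp only [Finset.mul_sum, ← Finset.sum_add_distrib, hPadd, hx]
    exact Finset.sum_congr rfl fun d _ => by ring
  have h4 : (∑ d, ∑ s', (u • π₁ + v • π₂) d * (G.T s a d).1 s' * G.R s a d s' θ) =
      u * (∑ d, ∑ s', π₁ d * (G.T s a d).1 s' * G.R s a d s' θ) +
      v * ∑ d, ∑ s', π₂ d * (G.T s a d).1 s' * G.R s a d s' θ := by
    simp only [Finset.mul_sum, ← Finset.sum_add_distrib, Pi.add_apply, Pi.smul_apply, smul_eq_mul]
    exact Finset.sum_congr rfl fun d _ => Finset.sum_congr rfl fun s' _ => by ring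
  rw [key, key, key, h3, h4]
  ring

/-! ### Concession sets and their geometry. -/

variable [Fintype Θ] [∀ s, Fintype (A s)]

/-- A bound for the discounted sums of rewards. -/
noncomputable def payoffBound (G : DualGame S Θ A D) : ℝ :=
  (∑ s, ∑ a : A s, ∑ d : D s, ∑ s', ∑ θ, |G.R s a d s' θ|) / (1 - G.γ)

theorem payoffBound_nonneg (G : DualGame S Θ A D) : 0 ≤ G.payoffBound :=
  div_nonneg (by positivity) (by linarith [G.γ_lt_one])

theorem abs_R_le (G : DualGame S Θ A D) (s : S) (a : A s) (d : D s) (s' : S) (θ : Θ) :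
    |G.R s a d s' θ| ≤ (1 - G.γ) * G.payoffBound := by
  have h1 : (1 - G.γ) ≠ 0 := by linarith [G.γ_lt_one]
  rw [payoffBound, mul_div_cancel₀ _ h1]
  refine le_trans ?_ (Finset.single_le_sum (fun s _ => by positivity) (Finset.mem_univ s))
  refine le_trans ?_ (Finset.single_le_sum (fun s _ => by positivity) (Finset.mem_univ a))
  refine le_trans ?_ (Finset.single_le_sum (fun s _ => by positivity) (Finset.mem_univ d))
  refine le_trans ?_ (Finset.single_le_sum (fun s _ => by positivity) (Finset.mem_univ s'))
  exact Finset.single_le_sum (f := fun θ => |G.R s a d s' θ|) (fun s _ => by positivity)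
    (Finset.mem_univ θ)

theorem abs_stageCost_le (G : DualGame S Θ A D) {s : S} {π : D s → ℝ} (hπ : π ∈ stdSimplex ℝ (D s))
    {x : A s → S → Θ → ℝ} (a : A s) (θ : Θ) (h : ∀ s', |x a s' θ| ≤ G.payoffBound) :
    |G.stageCost s π x a θ| ≤ G.payoffBound := by
  refine G.abs_defAvg_le hπ a fun d s' => (abs_add_le _ _).trans ?_
  rw [abs_mul, abs_of_nonneg G.γ_nonneg]
  have := mul_le_mul_of_nonneg_left (h s') G.γ_nonneg
  linarith [G.abs_R_le s a d s' θ]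

/-- The vectors that the defender can concede, in terms of what it can concede from the next stage
on. -/
def concessionStep (G : DualGame S Θ A D) (K : S → Set (Θ → ℝ)) (s : S) : Set (Θ → ℝ) :=
  {v | (∀ θ, |v θ| ≤ G.payoffBound) ∧ ∃ π ∈ stdSimplex ℝ (D s), ∃ x : A s → S → Θ → ℝ,
    (∀ a s', x a s' ∈ K s') ∧ ∀ a θ, G.stageCost s π x a θ ≤ v θ}

theorem concessionStep_mono (G : DualGame S Θ A D) : Monotone G.concessionStep :=
  fun _ _ h _ _ ⟨hv, π, hπ, x, hx, hle⟩ => ⟨hv, π, hπ, x, fun a s' => h s' (hx a s'), hle⟩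

theorem convex_concessionStep (G : DualGame S Θ A D) {K : S → Set (Θ → ℝ)}
    (hK : ∀ s, Convex ℝ (K s)) (s : S) : Convex ℝ (G.concessionStep K s) := by
  rintro v₁ ⟨b₁, π₁, h₁, x₁, k₁, l₁⟩ v₂ ⟨b₂, π₂, h₂, x₂, k₂, l₂⟩ u v hu hv huv
  obtain ⟨π, hπ, x, hx, e⟩ := G.exists_stageCost_eq hK h₁ h₂ k₁ k₂ hu hv huv
  refine ⟨fun θ => ?_, π, hπ, x, hx, fun a θ => ?_⟩
  · simp only [Pi.add_apply, Pi.smul_apply, smul_eq_mul]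
    refine (abs_add_le _ _).trans ?_
    rw [abs_mul, abs_mul, abs_of_nonneg hu, abs_of_nonneg hv]
    have e₁ := mul_le_mul_of_nonneg_left (b₁ θ) hu
    have e₂ := mul_le_mul_of_nonneg_left (b₂ θ) hv
    have : u * G.payoffBound + v * G.payoffBound = G.payoffBound := by rw [← add_mul, huv, one_mul]
    linarith
  · rw [e]
    exact add_le_add (mul_le_mul_of_nonneg_left (l₁ a θ) hu) (mul_le_mul_of_nonneg_left (l₂ a θ) hv)

/-- The set is the projection of the compact set of triples `(v, π, x)` cut out by the closed cost
inequalities. -/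
theorem isCompact_concessionStep (G : DualGame S Θ A D) {K : S → Set (Θ → ℝ)}
    (hK : ∀ s, IsCompact (K s)) (s : S) : IsCompact (G.concessionStep K s) := by
  have hbox : IsCompact {v : Θ → ℝ | ∀ θ, |v θ| ≤ G.payoffBound} := by
    have : {v : Θ → ℝ | ∀ θ, |v θ| ≤ G.payoffBound} =
        Set.pi Set.univ fun _ => Set.Icc (-G.payoffBound) G.payoffBound := by
      ext v; simp only [Set.mem_pi, Set.mem_univ, true_imp_iff, Set.mem_Icc, abs_le]; rfl
    rw [this]
    exact isCompact_univ_pi fun _ => isCompact_Icc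
  have hx : IsCompact {x : A s → S → Θ → ℝ | ∀ a s', x a s' ∈ K s'} := by
    have : {x : A s → S → Θ → ℝ | ∀ a s', x a s' ∈ K s'} =
        Set.pi Set.univ fun _ => Set.pi Set.univ K := by
      ext x; simp [Set.mem_pi]
    rw [this]
    exact isCompact_univ_pi fun _ => isCompact_univ_pi hK
  have hcl : IsClosed {p : (Θ → ℝ) × (D s → ℝ) × (A s → S → Θ → ℝ) |
      ∀ a θ, G.stageCost s p.2.1 p.2.2 a θ ≤ p.1 θ} := by
    have hc := (G.continuous_stageCost s).comp
      (continuous_snd (X := Θ → ℝ) (Y := (D s → ℝ) × (A s → S → Θ → ℝ)))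
    simp only [Set.ofPred_forall]
    refine isClosed_iInter fun a => isClosed_iInter fun θ => isClosed_le ?_ (by fun_prop)
    exact (continuous_apply θ).comp ((continuous_apply a).comp hc)
  convert ((hbox.prod ((isCompact_stdSimplex ℝ (D s)).prod hx)).inter_right hcl).image
    continuous_fst using 1
  ext v
  constructor
  · rintro ⟨hv, π, hπ, x, hx, hle⟩
    exact ⟨(v, π, x), ⟨⟨hv, hπ, hx⟩, hle⟩, rfl⟩
  · rintro ⟨⟨v, π, x⟩, ⟨⟨hv, hπ, hx⟩, hle⟩, rfl⟩
    exact ⟨hv, π, hπ, x, hx, hle⟩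

/-- The vectors `v` such that the defender has a strategy that concedes at most `v θ` for every
intent parameter `θ`: the greatest fixed point of `concessionStep`. -/
def concessions (G : DualGame S Θ A D) : S → Set (Θ → ℝ) :=
  OrderHom.gfp ⟨G.concessionStep, G.concessionStep_mono⟩

theorem concessionStep_concessions (G : DualGame S Θ A D) :
    G.concessionStep G.concessions = G.concessions :=
  OrderHom.map_gfp ⟨G.concessionStep, G.concessionStep_mono⟩

theorem le_concessions (G : DualGame S Θ A D) {K : S → Set (Θ → ℝ)} (h : K ≤ G.concessionStep K) :
    K ≤ G.concessions :=
  OrderHom.le_gfp ⟨G.concessionStep, G.concessionStep_mono⟩ h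

/-- Coinduction: the step operator preserves convexity, so the family of convex hulls is contained
in its own image and hence in the greatest fixed point. -/
theorem convex_concessions (G : DualGame S Θ A D) (s : S) : Convex ℝ (G.concessions s) := by
  have h1 : G.concessions ≤ fun s => convexHull ℝ (G.concessions s) :=
    fun s => subset_convexHull ℝ _
  have h2 : (fun s => convexHull ℝ (G.concessions s)) ≤ G.concessions := by
    refine G.le_concessions fun s => convexHull_min ?_ ?_
    · rw [← G.concessionStep_concessions]
      conv_rhs => rw [G.concessionStep_concessions]
      exact G.concessionStep_mono h1 s
    · exact G.convex_concessionStep (fun s => convex_convexHull ℝ _) s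
  have : G.concessions s = convexHull ℝ (G.concessions s) := (h1 s).antisymm (h2 s)
  rw [this]
  exact convex_convexHull ℝ _

theorem abs_le_of_mem_concessions (G : DualGame S Θ A D) {s : S} {v : Θ → ℝ}
    (hv : v ∈ G.concessions s) (θ : Θ) : |v θ| ≤ G.payoffBound := by
  rw [← G.concessionStep_concessions] at hv
  exact hv.1 θ

/-- The same coinduction with closures, which are compact by boundedness and which the step operator
sends to closed sets. -/
theorem isCompact_concessions (G : DualGame S Θ A D) (s : S) : IsCompact (G.concessions s) := by
  have hc (s : S) : IsCompact (closure (G.concessions s)) := by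
    refine Bornology.IsBounded.isCompact_closure ((Metric.isBounded_closedBall
      (x := (0 : Θ → ℝ)) (r := G.payoffBound)).subset fun v hv => ?_)
    rw [mem_closedBall_zero_iff, pi_norm_le_iff_of_nonneg G.payoffBound_nonneg]
    exact G.abs_le_of_mem_concessions hv
  have h1 : G.concessions ≤ fun s => closure (G.concessions s) := fun s => subset_closure
  have h2 : (fun s => closure (G.concessions s)) ≤ G.concessions := by
    refine G.le_concessions fun s => closure_minimal ?_ (G.isCompact_concessionStep hc s).isClosed
    have := G.concessionStep_mono h1 s
    rwa [G.concessionStep_concessions] at this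
  have : G.concessions s = closure (G.concessions s) := (h1 s).antisymm (h2 s)
  rw [this]
  exact hc s

/-- Promising `payoffBound` for every intent, now and forever, is self-consistent whatever the
defender plays. -/
theorem concessions_nonempty [∀ s, Nonempty (D s)] (G : DualGame S Θ A D) (s : S) :
    (G.concessions s).Nonempty := by
  have h : (fun _ : S => {fun _ : Θ => G.payoffBound}) ≤ G.concessions := by
    refine G.le_concessions fun s v hv => ?_
    rw [Set.mem_singleton_iff] at hv
    subst hv
    obtain ⟨π⟩ : Nonempty (stdSimplex ℝ (D s)) := inferInstance
    have hb : |G.payoffBound| ≤ G.payoffBound := (abs_of_nonneg G.payoffBound_nonneg).le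
    exact ⟨fun _ => hb, π.1, π.2, fun _ _ _ => G.payoffBound, fun _ _ => rfl,
      fun a θ => (abs_le.1 (G.abs_stageCost_le π.2 a θ fun _ => hb)).2⟩
  exact ⟨_, h s rfl⟩

theorem exists_stageCost_le (G : DualGame S Θ A D) {s : S} {v : Θ → ℝ}
    (hv : v ∈ G.concessions s) : ∃ π ∈ stdSimplex ℝ (D s), ∃ x : A s → S → Θ → ℝ,
      (∀ a s', x a s' ∈ G.concessions s') ∧ ∀ a θ, G.stageCost s π x a θ ≤ v θ := by
  rw [← G.concessionStep_concessions] at hv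
  exact hv.2

/-- Against a stage cost, the attacker has a best action for every intent parameter, and what the
defender thus concedes belongs to `concessions`. -/
theorem exists_best_response [∀ s, Nonempty (A s)] (G : DualGame S Θ A D) {s : S} {π : D s → ℝ}
    (hπ : π ∈ stdSimplex ℝ (D s)) {x : A s → S → Θ → ℝ}
    (hx : ∀ a s', x a s' ∈ G.concessions s') :
    ∃ b : Θ → A s, (fun θ => G.stageCost s π x (b θ) θ) ∈ G.concessions s := by
  choose b hb using fun θ => Finite.exists_max fun a => G.stageCost s π x a θ
  refine ⟨b, ?_⟩
  rw [← G.concessionStep_concessions]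
  exact ⟨fun θ => G.abs_stageCost_le hπ _ θ fun s' => G.abs_le_of_mem_concessions (hx _ s') θ,
    π, hπ, x, hx, fun a θ => hb θ a⟩

end

end DualGame

/-! ### Discounted rewards and their recursion. -/

theorem abs_sum_mul_le {ι : Type*} [Fintype ι] (p : stdSimplex ℝ ι) {f : ι → ℝ} {c : ℝ}
    (h : ∀ i, |f i| ≤ c) : |∑ i, p.1 i * f i| ≤ c := by
  calc |∑ i, p.1 i * f i| ≤ ∑ i, |p.1 i * f i| := Finset.abs_sum_le_sum_abs _ _
    _ ≤ ∑ i, p.1 i * c := Finset.sum_le_sum fun i _ => by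
        rw [abs_mul, abs_of_nonneg (p.2.1 i)]
        exact mul_le_mul_of_nonneg_left (h i) (p.2.1 i)
    _ = c := by rw [← Finset.sum_mul, p.2.2, one_mul]

theorem le_of_forall_le_add_pow {γ : ℝ} (h0 : 0 ≤ γ) (h1 : γ < 1) {x y c : ℝ}
    (h : ∀ n : ℕ, x ≤ y + γ ^ n * c) : x ≤ y := by
  have := ((tendsto_pow_atTop_nhds_zero_of_lt_one h0 h1).mul_const c).const_add y
  rw [zero_mul, add_zero] at this
  exact ge_of_tendsto' this h

namespace DualGame

section

variable {S Θ : Type*} {A D : S → Type*} [Fintype S] [∀ s, Fintype (A s)]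
  [∀ s, Fintype (D s)]

theorem stageReward_zero (G : DualGame S Θ A D) (θ : Θ)
    (α : Past A D → (s : S) → stdSimplex ℝ (A s)) (β : DefenderStrategy A D) (h : Past A D)
    (s : S) : G.stageReward θ α β 0 h s =
      ∑ a, (α h s).1 a * G.defAvg s (β h s).1 a fun d s' => G.R s a d s' θ := by
  simp only [stageReward, defAvg, Finset.mul_sum, mul_assoc]

theorem stageReward_succ (G : DualGame S Θ A D) (θ : Θ)
    (α : Past A D → (s : S) → stdSimplex ℝ (A s)) (β : DefenderStrategy A D) (t : ℕ)
    (h : Past A D) (s : S) : G.stageReward θ α β (t + 1) h s =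
      ∑ a, (α h s).1 a * G.defAvg s (β h s).1 a fun d s' =>
        G.stageReward θ α β t (h ++ [⟨s, (a, d)⟩]) s' := by
  simp only [stageReward, defAvg, Finset.mul_sum, mul_assoc]

variable [Fintype Θ]

theorem abs_stageReward_le (G : DualGame S Θ A D) (θ : Θ)
    (α : Past A D → (s : S) → stdSimplex ℝ (A s)) (β : DefenderStrategy A D) (t : ℕ)
    (h : Past A D) (s : S) : |G.stageReward θ α β t h s| ≤ (1 - G.γ) * G.payoffBound := by
  induction t generalizing h s with
  | zero =>
    rw [stageReward_zero]
    exact abs_sum_mul_le _ fun a => G.abs_defAvg_le (β h s).2 a fun d s' => G.abs_R_le s a d s' θ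
  | succ t ih =>
    rw [stageReward_succ]
    exact abs_sum_mul_le _ fun a => G.abs_defAvg_le (β h s).2 a fun d s' => ih _ _

/-- The conditional expectation, given the past and the current state, of the discounted sum of the
rewards from now on. -/
noncomputable def totalReward (G : DualGame S Θ A D) (θ : Θ)
    (α : Past A D → (s : S) → stdSimplex ℝ (A s)) (β : DefenderStrategy A D) (h : Past A D)
    (s : S) : ℝ :=
  ∑' t : ℕ, G.γ ^ t * G.stageReward θ α β t h s

theorem hasSum_bound (G : DualGame S Θ A D) :
    HasSum (fun t : ℕ => G.γ ^ t * ((1 - G.γ) * G.payoffBound)) G.payoffBound := by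
  have := (hasSum_geometric_of_lt_one G.γ_nonneg G.γ_lt_one).mul_right
    ((1 - G.γ) * G.payoffBound)
  rwa [inv_mul_cancel_left₀ (by linarith [G.γ_lt_one])] at this

theorem norm_stageReward_le (G : DualGame S Θ A D) (θ : Θ)
    (α : Past A D → (s : S) → stdSimplex ℝ (A s)) (β : DefenderStrategy A D) (h : Past A D)
    (s : S) (t : ℕ) : ‖G.γ ^ t * G.stageReward θ α β t h s‖ ≤
      G.γ ^ t * ((1 - G.γ) * G.payoffBound) := by
  have hγ : 0 ≤ G.γ ^ t := pow_nonneg G.γ_nonneg t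
  rw [Real.norm_eq_abs, abs_mul, abs_of_nonneg hγ]
  exact mul_le_mul_of_nonneg_left (G.abs_stageReward_le θ α β t h s) hγ

theorem summable_stageReward (G : DualGame S Θ A D) (θ : Θ)
    (α : Past A D → (s : S) → stdSimplex ℝ (A s)) (β : DefenderStrategy A D) (h : Past A D)
    (s : S) : Summable fun t : ℕ => G.γ ^ t * G.stageReward θ α β t h s :=
  Summable.of_norm_bounded G.hasSum_bound.summable (G.norm_stageReward_le θ α β h s)

theorem abs_totalReward_le (G : DualGame S Θ A D) (θ : Θ)
    (α : Past A D → (s : S) → stdSimplex ℝ (A s)) (β : DefenderStrategy A D) (h : Past A D)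
    (s : S) : |G.totalReward θ α β h s| ≤ G.payoffBound :=
  tsum_of_norm_bounded G.hasSum_bound (G.norm_stageReward_le θ α β h s)

/-- Conditioning on the first stage. This recursion and the uniform bound are all that the strategy
constructions use of the infinite series. -/
theorem totalReward_eq (G : DualGame S Θ A D) (θ : Θ)
    (α : Past A D → (s : S) → stdSimplex ℝ (A s)) (β : DefenderStrategy A D) (h : Past A D)
    (s : S) : G.totalReward θ α β h s =
      ∑ a, (α h s).1 a * G.defAvg s (β h s).1 a fun d s' =>
        G.R s a d s' θ + G.γ * G.totalReward θ α β (h ++ [⟨s, (a, d)⟩]) s' := by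
  have hs : HasSum (fun t : ℕ => G.γ ^ (t + 1) * G.stageReward θ α β (t + 1) h s)
      (∑ a, (α h s).1 a * G.defAvg s (β h s).1 a fun d s' =>
        G.γ * G.totalReward θ α β (h ++ [⟨s, (a, d)⟩]) s') := by
    have e (t : ℕ) : G.γ ^ (t + 1) * G.stageReward θ α β (t + 1) h s =
        ∑ a, (α h s).1 a * G.defAvg s (β h s).1 a fun d s' =>
          G.γ * (G.γ ^ t * G.stageReward θ α β t (h ++ [⟨s, (a, d)⟩]) s') := by
      simp only [defAvg_mul, stageReward_succ, Finset.mul_sum]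
      exact Finset.sum_congr rfl fun a _ => by ring
    simp only [e]
    refine hasSum_sum fun a _ => HasSum.mul_left _ ?_
    refine hasSum_sum fun d _ => hasSum_sum fun s' _ => HasSum.mul_left _ (HasSum.mul_left _ ?_)
    exact (G.summable_stageReward θ α β _ s').hasSum
  rw [totalReward, (G.summable_stageReward θ α β h s).tsum_eq_zero_add, hs.tsum_eq,
    stageReward_zero, pow_zero, one_mul, ← Finset.sum_add_distrib]
  simp only [defAvg_add, mul_add]

/-! ### Strategies of both players from the concession sets. -/

/-- The defender has a strategy that concedes at most `v s θ` in every initial state `s` and for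
every intent parameter `θ`, if every `v s` belongs to `concessions`. -/
theorem exists_defenderStrategy [∀ s, Nonempty (D s)] (G : DualGame S Θ A D) {v : S → Θ → ℝ}
    (hv : ∀ s, v s ∈ G.concessions s) : ∃ β : DefenderStrategy A D, ∀ s θ α,
      G.totalReward θ α β [] s ≤ v s θ := by
  have H (s : S) (v : Θ → ℝ) : ∃ (π : stdSimplex ℝ (D s)) (x : A s → S → Θ → ℝ),
      v ∈ G.concessions s → (∀ a s', x a s' ∈ G.concessions s') ∧
        ∀ a θ, G.stageCost s π.1 x a θ ≤ v θ := by
    by_cases hv : v ∈ G.concessions s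
    · obtain ⟨π, hπ, x, h⟩ := G.exists_stageCost_le hv
      exact ⟨⟨π, hπ⟩, x, fun _ => h⟩
    · exact ⟨Classical.arbitrary _, fun _ _ => v, fun h => (hv h).elim⟩
  choose π x hx using H
  -- `y h s` is the vector still promised after the past `h` in state `s`; it depends on the visited
  -- states and the attacker's actions, all public.
  let y (h : Past A D) : S → Θ → ℝ :=
    h.foldl (fun y e => x e.1 (y e.1) e.2.1) v
  have hy (h : Past A D) (s : S) (a : A s) (d : D s) :
      y (h ++ [⟨s, (a, d)⟩]) = x s (y h s) a := by
    simp [y, List.foldl_append]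
  let β : DefenderStrategy A D := fun h s => π s (y h s)
  refine ⟨β, fun s θ α => ?_⟩
  -- Unrolling `n` stages leaves an error of at most `γ ^ n` times the largest gap, `2 *
  -- payoffBound`, between a payoff and a promise.
  have key (n : ℕ) : ∀ h s, (∀ s', y h s' ∈ G.concessions s') →
      G.totalReward θ α β h s ≤ y h s θ + G.γ ^ n * (2 * G.payoffBound) := by
    induction n with
    | zero =>
      intro h s hh
      have h1 := (abs_le.1 (G.abs_totalReward_le θ α β h s)).2
      have h2 := (abs_le.1 (G.abs_le_of_mem_concessions (hh s) θ)).1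
      rw [pow_zero]
      linarith
    | succ n ih =>
      intro h s hh
      obtain ⟨hxc, hxv⟩ := hx s (y h s) (hh s)
      set c := G.γ ^ (n + 1) * (2 * G.payoffBound) with hc
      have step (a : A s) : (G.defAvg s (β h s).1 a fun d s' =>
          G.R s a d s' θ + G.γ * G.totalReward θ α β (h ++ [⟨s, (a, d)⟩]) s') ≤
          y h s θ + c := by
        calc _ ≤ G.defAvg s (β h s).1 a fun d s' =>
              (G.R s a d s' θ + G.γ * x s (y h s) a s' θ) + c := by
              refine G.defAvg_mono (β h s).2.1 a fun d s' => ?_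
              have := ih (h ++ [⟨s, (a, d)⟩]) s' (by rw [hy]; exact hxc a)
              rw [hy] at this
              have := mul_le_mul_of_nonneg_left this G.γ_nonneg
              rw [hc, pow_succ]
              linarith
          _ = G.stageCost s (π s (y h s)).1 (x s (y h s)) a θ + c := by
              rw [defAvg_add, G.defAvg_const (β h s).2.2, stageCost]
          _ ≤ y h s θ + c := by linarith [hxv a θ]
      rw [totalReward_eq]
      calc _ ≤ ∑ a, (α h s).1 a * (y h s θ + c) :=
            Finset.sum_le_sum fun a _ => mul_le_mul_of_nonneg_left (step a) ((α h s).2.1 a)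
        _ = y h s θ + c := by rw [← Finset.sum_mul, (α h s).2.2, one_mul]
  exact le_of_forall_le_add_pow G.γ_nonneg G.γ_lt_one fun n => key n [] s hv

/-- Given the weights `q` of the intent parameters, the attacker has a mixed action for each of them
that guarantees the minimum of `q` over `concessions`. -/
theorem exists_attacker_action [∀ s, Nonempty (A s)] [∀ s, Nonempty (D s)]
    (G : DualGame S Θ A D) (s : S) {q : Θ → ℝ} {c : ℝ}
    (hc : ∀ v ∈ G.concessions s, c ≤ ∑ θ, q θ * v θ) :
    ∃ κ : Θ → stdSimplex ℝ (A s), ∀ π ∈ stdSimplex ℝ (D s), ∀ x : A s → S → Θ → ℝ,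
      (∀ a s', x a s' ∈ G.concessions s') →
        c ≤ ∑ θ, ∑ a, q θ * (κ θ).1 a * G.stageCost s π x a θ := by
  classical
  -- The minimax is played over cost matrices rather than over pairs `(π, x)`: the payoff is linear
  -- in the matrix, and the set of matrices is convex by `exists_stageCost_eq`.
  let X : Set (A s → Θ → ℝ) := (fun p : (D s → ℝ) × (A s → S → Θ → ℝ) =>
    G.stageCost s p.1 p.2) '' (stdSimplex ℝ (D s) ×ˢ
      Set.pi Set.univ fun _ => Set.pi Set.univ G.concessions)
  let Y : Set (Θ → A s → ℝ) := Set.pi Set.univ fun _ => stdSimplex ℝ (A s)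
  have hX : IsCompact X := by
    refine IsCompact.image ?_ (G.continuous_stageCost s)
    exact (isCompact_stdSimplex ℝ _).prod
      (isCompact_univ_pi fun _ => isCompact_univ_pi G.isCompact_concessions)
  have nX : X.Nonempty := by
    obtain ⟨π⟩ : Nonempty (stdSimplex ℝ (D s)) := inferInstance
    choose v hv using G.concessions_nonempty
    exact ⟨_, (π.1, fun _ => v), ⟨π.2, fun _ _ s' _ => hv s'⟩, rfl⟩
  have cX : Convex ℝ X := by
    rintro _ ⟨⟨π₁, x₁⟩, ⟨h₁, k₁⟩, rfl⟩ _ ⟨⟨π₂, x₂⟩, ⟨h₂, k₂⟩, rfl⟩ u v hu hv huv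
    obtain ⟨π, hπ, x, hx, e⟩ := G.exists_stageCost_eq G.convex_concessions h₁ h₂
      (fun a s' => k₁ a trivial s' trivial) (fun a s' => k₂ a trivial s' trivial) hu hv huv
    exact ⟨(π, x), ⟨hπ, fun a _ s' _ => hx a s'⟩, funext₂ e⟩
  have hY : IsCompact Y := isCompact_univ_pi fun _ => isCompact_stdSimplex ℝ _
  have cY : Convex ℝ Y := convex_pi fun _ _ => convex_stdSimplex ℝ _
  have nY : Y.Nonempty := by
    obtain ⟨μ⟩ : Nonempty (stdSimplex ℝ (A s)) := inferInstance
    exact ⟨fun _ => μ.1, fun _ _ => μ.2⟩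
  obtain ⟨κ, hκ, h⟩ := exists_forall_le_of_forall_exists_le (X := X) (Y := Y)
    (fun g κ => ∑ θ, ∑ a, q θ * κ θ a * g a θ) hX cX nX hY cY nY
    (fun _ => by fun_prop) (fun _ => by fun_prop)
    (fun g κ κ' a b _ => by
      simp only [Finset.mul_sum, ← Finset.sum_add_distrib, Pi.add_apply, Pi.smul_apply,
        smul_eq_mul]
      exact Finset.sum_congr rfl fun θ _ => Finset.sum_congr rfl fun a _ => by ring)
    (fun κ g g' a b _ => by
      simp only [Finset.mul_sum, ← Finset.sum_add_distrib, Pi.add_apply, Pi.smul_apply,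
        smul_eq_mul]
      exact Finset.sum_congr rfl fun θ _ => Finset.sum_congr rfl fun a _ => by ring)
    -- Against a known matrix the attacker plays a pure best action for each intent; the resulting
    -- cost vector is concedable, so `hc` applies.
    (c := c) (by
      rintro _ ⟨⟨π, x⟩, ⟨hπ, hx⟩, rfl⟩
      obtain ⟨b, hb⟩ := G.exists_best_response hπ fun a s' => hx a trivial s' trivial
      refine ⟨fun θ => Pi.single (b θ) 1, fun θ _ => single_mem_stdSimplex ℝ (b θ), ?_⟩
      refine (hc _ hb).trans_eq (Finset.sum_congr rfl fun θ _ => ?_)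
      simp [Pi.single_apply])
  exact ⟨fun θ => ⟨κ θ, hκ θ trivial⟩, fun π hπ x hx =>
    h _ ⟨(π, x), ⟨hπ, fun a _ s' _ => hx a s'⟩, rfl⟩⟩

/-- If the attacker chooses the intent parameter according to `p`, it can guarantee the minimum of
`p` over `concessions`. -/
theorem exists_attackerStrategy [∀ s, Nonempty (A s)] [∀ s, Nonempty (D s)]
    (G : DualGame S Θ A D) (p : stdSimplex ℝ Θ) :
    ∃ α : Θ → Past A D → (s : S) → stdSimplex ℝ (A s), ∀ (s : S) (β : DefenderStrategy A D),
      ∃ v ∈ G.concessions s, ∑ θ, p.1 θ * v θ ≤ ∑ θ, p.1 θ * G.totalReward θ (α θ) β [] s := by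
  have hmin (s : S) (q : Θ → ℝ) : ∃ v ∈ G.concessions s, ∀ v' ∈ G.concessions s,
      ∑ θ, q θ * v θ ≤ ∑ θ, q θ * v' θ := by
    have hf : Continuous fun v : Θ → ℝ => ∑ θ, q θ * v θ := by fun_prop
    obtain ⟨v, hv, h⟩ := (G.isCompact_concessions s).exists_isMinOn (G.concessions_nonempty s)
      hf.continuousOn
    exact ⟨v, hv, fun v' hv' => h hv'⟩
  choose m hm hmin using hmin
  have H (s : S) (q : Θ → ℝ) : ∃ κ : Θ → stdSimplex ℝ (A s),
      ∀ π ∈ stdSimplex ℝ (D s), ∀ x : A s → S → Θ → ℝ, (∀ a s', x a s' ∈ G.concessions s') →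
        ∑ θ, q θ * m s q θ ≤ ∑ θ, ∑ a, q θ * (κ θ).1 a * G.stageCost s π x a θ :=
    G.exists_attacker_action s (hmin s q)
  choose κ hκ using H
  -- Unnormalized posterior: the prior times the attacker's own action probabilities. The factors of
  -- the defender and of the transitions do not depend on `θ` and are dropped; without
  -- normalization, null events need no separate treatment.
  let q (h : Past A D) : Θ → ℝ :=
    h.foldl (fun q e θ => q θ * (κ e.1 q θ).1 e.2.1) p.1
  have hq (h : Past A D) (s : S) (a : A s) (d : D s) :
      q (h ++ [⟨s, (a, d)⟩]) = fun θ => q h θ * (κ s (q h) θ).1 a := by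
    simp [q, List.foldl_append]
  let α : Θ → Past A D → (s : S) → stdSimplex ℝ (A s) := fun θ h s => κ s (q h) θ
  refine ⟨α, fun s β => ⟨m s p.1, hm s p.1, ?_⟩⟩
  -- The error is proportional to the mass of `q h`, so that the errors after the various actions
  -- `a` add up to the required one.
  have key (n : ℕ) : ∀ h s, (∀ θ, 0 ≤ q h θ) → ∑ θ, q h θ * m s (q h) θ ≤
      ∑ θ, q h θ * G.totalReward θ (α θ) β h s +
        G.γ ^ n * (2 * G.payoffBound * ∑ θ, q h θ) := by
    induction n with
    | zero =>
      intro h s hh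
      rw [pow_zero, one_mul, Finset.mul_sum, ← Finset.sum_add_distrib]
      refine Finset.sum_le_sum fun θ _ => ?_
      have h1 := (abs_le.1 (G.abs_totalReward_le θ (α θ) β h s)).1
      have h2 := (abs_le.1 (G.abs_le_of_mem_concessions (hm s (q h)) θ)).2
      have := mul_le_mul_of_nonneg_left
        (show m s (q h) θ ≤ G.totalReward θ (α θ) β h s + 2 * G.payoffBound by linarith) (hh θ)
      linarith
    | succ n ih =>
      intro h s hh
      let r (a : A s) : Θ → ℝ := fun θ => q h θ * (κ s (q h) θ).1 a
      have hr (a : A s) (θ : Θ) : 0 ≤ r a θ := mul_nonneg (hh θ) ((κ s (q h) θ).2.1 a)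
      have hrsum : ∑ a, ∑ θ, r a θ = ∑ θ, q h θ := by
        rw [Finset.sum_comm]
        refine Finset.sum_congr rfl fun θ _ => ?_
        rw [← Finset.mul_sum, (κ s (q h) θ).2.2, mul_one]
      let c (a : A s) : ℝ := G.γ ^ (n + 1) * (2 * G.payoffBound * ∑ θ, r a θ)
      -- The continuation is the concession that is cheapest for the updated weights `r a`; this is
      -- the vector that the induction hypothesis bounds.
      let x (a : A s) (s' : S) : Θ → ℝ := m s' (r a)
      let U (a : A s) (d : D s) (s' : S) (θ : Θ) : ℝ :=
        G.totalReward θ (α θ) β (h ++ [⟨s, (a, d)⟩]) s'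
      have hsc : ∑ a, c a = G.γ ^ (n + 1) * (2 * G.payoffBound * ∑ θ, q h θ) := by
        simp only [c, ← Finset.mul_sum, hrsum]
      have step (a : A s) : ∑ θ, r a θ * G.stageCost s (β h s).1 x a θ ≤
          (∑ θ, r a θ * G.defAvg s (β h s).1 a fun d s' =>
            G.R s a d s' θ + G.γ * U a d s' θ) + c a := by
        simp only [stageCost, ← defAvg_mul, ← defAvg_sum]
        rw [← G.defAvg_const (β h s).2.2 a (c a), ← defAvg_add]
        refine G.defAvg_mono (β h s).2.1 a fun d s' => ?_
        have := ih (h ++ [⟨s, (a, d)⟩]) s' (by rw [hq]; exact hr a)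
        rw [hq] at this
        have := mul_le_mul_of_nonneg_left this G.γ_nonneg
        have e (f : Θ → ℝ) : ∑ θ, r a θ * (G.R s a d s' θ + G.γ * f θ) =
            ∑ θ, r a θ * G.R s a d s' θ + G.γ * ∑ θ, r a θ * f θ := by
          rw [Finset.mul_sum, ← Finset.sum_add_distrib]
          exact Finset.sum_congr rfl fun θ _ => by ring
        rw [e, e]
        simp only [c, pow_succ, x, U, r] at this ⊢
        linarith
      calc ∑ θ, q h θ * m s (q h) θ
          ≤ ∑ θ, ∑ a, q h θ * (κ s (q h) θ).1 a * G.stageCost s (β h s).1 x a θ :=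
            hκ s (q h) (β h s).1 (β h s).2 x fun a s' => hm s' (r a)
        _ = ∑ a, ∑ θ, r a θ * G.stageCost s (β h s).1 x a θ := Finset.sum_comm
        _ ≤ _ := Finset.sum_le_sum fun a _ => step a
        _ = _ := by
          rw [Finset.sum_add_distrib, hsc, Finset.sum_comm]
          congr 1
          refine Finset.sum_congr rfl fun θ _ => ?_
          rw [totalReward_eq, Finset.mul_sum]
          exact Finset.sum_congr rfl fun a _ => mul_assoc _ _ _
  exact le_of_forall_le_add_pow G.γ_nonneg G.γ_lt_one fun n => key n [] s p.2.1

end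

end DualGame

/-! ### The value as a minimum over concessions, and the Bellman equation. -/

namespace DualGame

section

variable {S Θ : Type*} {A D : S → Type*} [Fintype S] [Fintype Θ] [∀ s, Fintype (A s)]
  [∀ s, Fintype (D s)]

/-- In state `s` the defender can concede, in excess of `-ζ`, at most `c` and no less than `c`. -/
def IsConcessionValue (G : DualGame S Θ A D) (s : S) (ζ : Θ → ℝ) (c : ℝ) : Prop :=
  (∃ v ∈ G.concessions s, ∀ θ, ζ θ + v θ ≤ c) ∧ ∀ v ∈ G.concessions s, ∃ θ, c ≤ ζ θ + v θ

theorem exists_isConcessionValue [Nonempty Θ] [∀ s, Nonempty (D s)] (G : DualGame S Θ A D) (s : S)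
    (ζ : Θ → ℝ) : ∃ c, G.IsConcessionValue s ζ c := by
  let f (v : Θ → ℝ) : ℝ := Finset.univ.sup' Finset.univ_nonempty fun θ => ζ θ + v θ
  have hf : Continuous f := Continuous.finset_sup'_apply _ fun θ _ => by fun_prop
  obtain ⟨v, hv, h⟩ := (G.isCompact_concessions s).exists_isMinOn (G.concessions_nonempty s)
    hf.continuousOn
  refine ⟨f v, ⟨v, hv, fun θ => Finset.le_sup' (fun θ => ζ θ + v θ) (Finset.mem_univ θ)⟩,
    fun v' hv' => ?_⟩
  obtain ⟨θ, -, hθ⟩ := Finset.exists_mem_eq_sup' Finset.univ_nonempty fun θ => ζ θ + v' θ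
  exact ⟨θ, hθ ▸ h hv'⟩

/-- Minimax between concessions and priors: against each `v`, a point mass at a worst intent secures
`c`, hence one prior secures it against all `v`. -/
theorem IsConcessionValue.exists_prior [Nonempty Θ] [∀ s, Nonempty (D s)] {G : DualGame S Θ A D}
    {s : S} {ζ : Θ → ℝ} {c : ℝ} (h : G.IsConcessionValue s ζ c) :
    ∃ p : stdSimplex ℝ Θ, ∀ v ∈ G.concessions s, c ≤ ∑ θ, p.1 θ * (ζ θ + v θ) := by
  classical
  obtain ⟨p₀⟩ : Nonempty (stdSimplex ℝ Θ) := inferInstance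
  obtain ⟨p, hp, h⟩ := exists_forall_le_of_forall_exists_le
    (fun (v p : Θ → ℝ) => ∑ θ, p θ * (ζ θ + v θ)) (G.isCompact_concessions s)
    (G.convex_concessions s) (G.concessions_nonempty s) (isCompact_stdSimplex ℝ Θ)
    (convex_stdSimplex ℝ Θ) ⟨p₀.1, p₀.2⟩
    (fun _ => by fun_prop) (fun _ => by fun_prop)
    (fun v p p' a b _ => by
      simp only [Finset.mul_sum, ← Finset.sum_add_distrib, Pi.add_apply, Pi.smul_apply,
        smul_eq_mul]
      exact Finset.sum_congr rfl fun θ _ => by ring)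
    (fun p v v' a b hab => by
      simp only [Finset.mul_sum, ← Finset.sum_add_distrib, Pi.add_apply, Pi.smul_apply,
        smul_eq_mul]
      refine Finset.sum_congr rfl fun θ _ => ?_
      -- The term `ζ θ` makes the payoff affine, not linear, in `v`, so `a + b = 1` is needed.
      rw [eq_sub_of_add_eq hab]
      ring)
    (c := c) fun v hv => by
      obtain ⟨θ, hθ⟩ := h.2 v hv
      refine ⟨Pi.single θ 1, single_mem_stdSimplex ℝ θ, hθ.trans_eq ?_⟩
      simp [Pi.single_apply]
  exact ⟨⟨p, hp⟩, h⟩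

theorem dualPayoff_eq (G : DualGame S Θ A D) (s : S) (ζ : Θ → ℝ) (σ : AttackerStrategy Θ A D)
    (β : DefenderStrategy A D) : G.dualPayoff s ζ σ β =
      ∑ θ, (σ.intent s).1 θ * (ζ θ + G.totalReward θ (σ.act θ) β [] s) := rfl

theorem abs_dualPayoff_le (G : DualGame S Θ A D) (s : S) (ζ : Θ → ℝ) (σ : AttackerStrategy Θ A D)
    (β : DefenderStrategy A D) : |G.dualPayoff s ζ σ β| ≤ ∑ θ, |ζ θ| + G.payoffBound := by
  rw [dualPayoff_eq]
  refine abs_sum_mul_le _ fun θ => (abs_add_le _ _).trans (add_le_add ?_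
    (G.abs_totalReward_le θ _ β [] s))
  exact Finset.single_le_sum (f := fun θ => |ζ θ|) (fun _ _ => abs_nonneg _) (Finset.mem_univ θ)

/-- A number that each player can guarantee is the maximin value. -/
theorem dualValue_eq_of_optimal (G : DualGame S Θ A D) {s : S} {ζ : Θ → ℝ} {c : ℝ}
    {σ₀ : AttackerStrategy Θ A D} {β₀ : DefenderStrategy A D}
    (hσ : ∀ β, c ≤ G.dualPayoff s ζ σ₀ β) (hβ : ∀ σ, G.dualPayoff s ζ σ β₀ ≤ c) :
    G.dualValue s ζ = c := by
  have : Nonempty (AttackerStrategy Θ A D) := ⟨σ₀⟩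
  have : Nonempty (DefenderStrategy A D) := ⟨β₀⟩
  have hle (σ : AttackerStrategy Θ A D) : ⨅ β, G.dualPayoff s ζ σ β ≤ c :=
    (ciInf_le ⟨-(∑ θ, |ζ θ| + G.payoffBound), by
      rintro _ ⟨β, rfl⟩
      exact (abs_le.1 (G.abs_dualPayoff_le s ζ σ β)).1⟩ β₀).trans (hβ σ)
  refine le_antisymm (ciSup_le hle) ?_
  exact (le_ciInf hσ).trans (le_ciSup (f := fun σ => ⨅ β, G.dualPayoff s ζ σ β)
    ⟨c, by rintro _ ⟨σ, rfl⟩; exact hle σ⟩ σ₀)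

/-- Both players can guarantee the concession value. -/
theorem IsConcessionValue.exists_optimal [Nonempty Θ] [∀ s, Nonempty (A s)] [∀ s, Nonempty (D s)]
    {G : DualGame S Θ A D} {s : S} {ζ : Θ → ℝ} {c : ℝ} (h : G.IsConcessionValue s ζ c) :
    ∃ (σ₀ : AttackerStrategy Θ A D) (β₀ : DefenderStrategy A D),
      (∀ β, c ≤ G.dualPayoff s ζ σ₀ β) ∧ ∀ σ, G.dualPayoff s ζ σ β₀ ≤ c := by
  classical
  obtain ⟨p, hp⟩ := h.exists_prior
  obtain ⟨α, hα⟩ := G.exists_attackerStrategy p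
  obtain ⟨v, hv, hvc⟩ := h.1
  choose u hu using G.concessions_nonempty
  -- The construction needs an initial promise in every state; only the one at `s` matters here.
  obtain ⟨β₀, hβ₀⟩ := G.exists_defenderStrategy (v := Function.update u s v) fun s' => by
    rcases eq_or_ne s' s with rfl | hs
    · simpa using hv
    · simpa [hs] using hu s'
  refine ⟨⟨fun _ => p, α⟩, β₀, fun β => ?_, fun σ => ?_⟩
  · obtain ⟨v', hv', hle⟩ := hα s β
    refine (hp v' hv').trans ?_
    rw [dualPayoff_eq]
    simp only [mul_add, Finset.sum_add_distrib]
    linarith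
  · rw [dualPayoff_eq]
    calc _ ≤ ∑ θ, (σ.intent s).1 θ * c := by
          refine Finset.sum_le_sum fun θ _ => mul_le_mul_of_nonneg_left ?_ ((σ.intent s).2.1 θ)
          have := hβ₀ s θ (σ.act θ)
          rw [Function.update_self] at this
          linarith [hvc θ]
      _ = c := by rw [← Finset.sum_mul, (σ.intent s).2.2, one_mul]

theorem isConcessionValue_dualValue [Nonempty Θ] [∀ s, Nonempty (A s)] [∀ s, Nonempty (D s)]
    (G : DualGame S Θ A D) (s : S) (ζ : Θ → ℝ) :
    G.IsConcessionValue s ζ (G.dualValue s ζ) := by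
  obtain ⟨c, hc⟩ := G.exists_isConcessionValue s ζ
  obtain ⟨σ₀, β₀, hσ, hβ⟩ := hc.exists_optimal
  rwa [G.dualValue_eq_of_optimal hσ hβ]

/-- The payoff of the one-stage game is an average of stage costs. -/
theorem instReward_add_contReward (G : DualGame S Θ A D) (w : S → (Θ → ℝ) → ℝ) (s : S)
    (ζ : Θ → ℝ) (π : stdSimplex ℝ (D s)) (ξ : A s → S → Θ → ℝ) (μ : stdSimplex ℝ (A s × Θ)) :
    G.instReward s ζ π μ + G.γ * G.contReward w s π ξ μ = ∑ i : A s × Θ, μ.1 i *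
      (ζ i.2 + G.stageCost s π.1 (fun a s' θ => w s' (ξ a s') - ξ a s' θ) i.1 i.2) := by
  have hc : G.contReward w s π ξ μ = ∑ a : A s, ∑ θ : Θ, μ.1 (a, θ) *
      G.defAvg s π.1 a fun _ s' => w s' (ξ a s') - ξ a s' θ := by
    simp only [contReward, defAvg, Finset.mul_sum]
    refine Finset.sum_congr rfl fun a _ => ?_
    rw [Finset.sum_comm, Finset.sum_comm (s := (Finset.univ : Finset Θ))]
    rw [Finset.sum_comm]
    refine Finset.sum_congr rfl fun d _ => ?_
    rw [Finset.sum_comm]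
    exact Finset.sum_congr rfl fun θ _ => Finset.sum_congr rfl fun s' _ => by ring
  rw [hc, instReward, Fintype.sum_prod_type, Finset.mul_sum, ← Finset.sum_add_distrib]
  refine Finset.sum_congr rfl fun a _ => ?_
  rw [Finset.mul_sum, ← Finset.sum_add_distrib]
  refine Finset.sum_congr rfl fun θ _ => ?_
  rw [stageCost, defAvg_add, defAvg_mul]
  simp only [defAvg]
  ring

theorem isGreatest_range_stdSimplex {ι : Type*} [Fintype ι] (f : ι → ℝ) (i : ι)
    (hi : ∀ j, f j ≤ f i) :
    IsGreatest (Set.range fun μ : stdSimplex ℝ ι => ∑ j, μ.1 j * f j) (f i) := by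
  classical
  refine ⟨⟨⟨Pi.single i 1, single_mem_stdSimplex ℝ i⟩, ?_⟩, ?_⟩
  · simp [Pi.single_apply]
  · rintro _ ⟨μ, rfl⟩
    calc ∑ j, μ.1 j * f j ≤ ∑ j, μ.1 j * f i :=
          Finset.sum_le_sum fun j _ => mul_le_mul_of_nonneg_left (hi j) (μ.2.1 j)
      _ = f i := by rw [← Finset.sum_mul, μ.2.2, one_mul]

/-- Concession values satisfy the Bellman equation of the dual game. -/
theorem isDualBackup_of_isConcessionValue [Nonempty Θ] [∀ s, Nonempty (A s)]
    (G : DualGame S Θ A D) {w : S → (Θ → ℝ) → ℝ}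
    (hw : ∀ s ζ, G.IsConcessionValue s ζ (w s ζ)) (s : S) (ζ : Θ → ℝ) :
    G.IsDualBackup w s ζ (w s ζ) := by
  have lower (π : stdSimplex ℝ (D s)) (ξ : A s → S → Θ → ℝ) : ∃ i : A s × Θ, w s ζ ≤
      ζ i.2 + G.stageCost s π.1 (fun a s' θ => w s' (ξ a s') - ξ a s' θ) i.1 i.2 := by
    -- The vector `w s' (ξ a s') - ξ a s'` dominates a concedable `x a s'`, so the best response to
    -- `x` bounds the cost from below.
    choose x hx hxle using fun a s' => (hw s' (ξ a s')).1
    obtain ⟨b, hb⟩ := G.exists_best_response π.2 hx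
    obtain ⟨θ, hθ⟩ := (hw s ζ).2 _ hb
    have := G.stageCost_mono π.2.1 (x := x) (y := fun a s' θ => w s' (ξ a s') - ξ a s' θ)
      (b θ) θ fun s' => by linarith [hxle (b θ) s' θ]
    exact ⟨(b θ, θ), by simp only; linarith⟩
  unfold IsDualBackup
  simp only [instReward_add_contReward]
  constructor
  · obtain ⟨v, hv, hvw⟩ := (hw s ζ).1
    obtain ⟨π, hπ, x, hx, hle⟩ := G.exists_stageCost_le hv
    have upper (i : A s × Θ) : ζ i.2 + G.stageCost s π
        (fun a s' θ => w s' (-x a s') - (-x a s') θ) i.1 i.2 ≤ w s ζ := by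
      have := G.stageCost_mono hπ.1 (x := fun a s' θ => w s' (-x a s') - (-x a s') θ) (y := x)
        i.1 i.2 fun s' => by
          -- Testing the value at `-x` against the concession `x` gives `w s' (-x) ≤ 0`.
          obtain ⟨θ, hθ⟩ := (hw s' (-x i.1 s')).2 _ (hx i.1 s')
          simp only [Pi.neg_apply] at hθ ⊢
          linarith
      linarith [hle i.1 i.2, hvw i.2]
    obtain ⟨i, hi⟩ := lower ⟨π, hπ⟩ fun a s' => -x a s'
    refine ⟨⟨π, hπ⟩, fun a s' => -x a s', ?_⟩
    rw [hi.antisymm (upper i)]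
    exact isGreatest_range_stdSimplex _ i fun j => (upper j).trans hi
  · rintro m ⟨π, ξ, hm⟩
    obtain ⟨i, hi⟩ := lower π ξ
    classical
    refine hi.trans (hm.2 ⟨⟨Pi.single i 1, single_mem_stdSimplex ℝ i⟩, ?_⟩)
    simp [Pi.single_apply]

end

end DualGame

/-- The dual game has a value, which is attained by optimal strategies of both players, and the value
function `w` satisfies `w = H w` for the dual value backup operator `H`. -/
theorem proposition2 {S Θ : Type*} {A D : S → Type*} [Fintype S] [Fintype Θ] [Nonempty Θ]
    [∀ s, Fintype (A s)] [∀ s, Nonempty (A s)] [∀ s, Fintype (D s)] [∀ s, Nonempty (D s)]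
    (G : DualGame S Θ A D) (s : S) (ζ : Θ → ℝ) :
    (∃ (σ₀ : DualGame.AttackerStrategy Θ A D) (β₀ : DualGame.DefenderStrategy A D),
      (∀ β, G.dualValue s ζ ≤ G.dualPayoff s ζ σ₀ β) ∧
      (∀ σ, G.dualPayoff s ζ σ β₀ ≤ G.dualValue s ζ)) ∧
    G.IsDualBackup G.dualValue s ζ (G.dualValue s ζ) :=
  ⟨(G.isConcessionValue_dualValue s ζ).exists_optimal,
    G.isDualBackup_of_isConcessionValue G.isConcessionValue_dualValue s ζ⟩
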